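/- Let $\mathcal H$ be the upper half plane, $\mathrm{Hol}$ the algebra of holomorphic functions on $\mathcal H$, and $\mathcal M(k)$ the space of holomorphic modular forms of weight $k$ on $\mathrm{SL}(2,\mathbb Z)$. Let $E_2,E_4,E_6$ be the Eisenstein series normalized to have constant term $1$. For $k\in\mathbb R$ put $D_kf=\frac1{2\pi i}\frac{df}{dz}-\frac{k}{12}E_2f$, $D_k^0=1$ and $D_k^{N}=D_{k+2N-2}\cdots D_{k+2}D_k$. A modular linear differential equation (MLDE) of weight $k$ and order $N$ is an equation $$(g_0D_k^N+g_1D_k^{N-1}+\cdots+g_N)f=0,\qquad g_i\in\mathcal M(l+2i),\quad g_0\ne0,$$ for some integer $l\ge0$; it is monic if $l=0$ and $g_0=1$. Let $H=\bigoplus_{r\in\mathbb R}H_r$ with $H_r=\mathrm{Hol}$, and write $(f,r)$ for $f\in\mathrm{Hol}$ placed in degree $r$. Let $\delta,e_4,e_6$ be the $\mathbb C$-linear endomorphisms of $H$ with $\delta(f,r)=(D_rf,r+2)$, $e_4(f,r)=(E_4f,r+4)$, $e_6(f,r)=(E_6f,r+6)$, and let $\mathcal R$ be the $\mathbb C$-algebra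 generated by $\delta,e_4,e_6$. An element of $\mathcal R$ is called monic of order $N\ge0$ if it has the form $\delta^N+a_{N-1}\delta^{N-1}+\cdots+a_1\delta+a_0$ with every $a_i$ in the subalgebra $\mathbb C[e_4,e_6]$. For $\phi\in H$ the modular order $\mathrm{mord}(\phi)\in\{0,1,2,\dots,\infty\}$ is the least $N\ge 0$ such that some monic element of $\mathcal R$ of order $N$ annihilates $\phi$, and $\infty$ if there is none. The function $E_4^mE_6^n$ is regarded as the element $(E_4^mE_6^n,4m+6n)$ of $H$. **Theorem.** (i) Let $m,n\ge0$ and $N\ge1$ be integers. If $E_4^mE_6^n$ satisfies a monic MLDE of weight $4m+6n$ and order $N$, then $N\ge\max\{m,n\}+1$. (ii) For all integers $m,n\ge0$, $\mathrm{mord}(E_4^mE_6^n)\ge\max\{m,n\}+1$. (iii) For every integer $n\ge0$, $\mathrm{mord}(E_4^n)=\mathrm{mord}(E_6^n)=\mathrm{mord}(E_4^nE_6^n)=n+1$. -/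

import Mathlib

namespace ModularLDE

open UpperHalfPlane
open scoped Manifold MatrixGroups DirectSum

noncomputable section

/-- The algebra of all holomorphic functions on the upper half plane. -/
def Hol : Subalgebra ℂ (ℍ → ℂ) where
  carrier := {f | MDiff f}
  mul_mem' {_ _} hf hg := MDifferentiable.mul hf hg
  add_mem' {_ _} hf hg := MDifferentiable.add hf hg
  algebraMap_mem' _ := mdifferentiable_const

/-- A modular form of level one, as a holomorphic function. -/
def formToHol {k : ℤ} (g : ModularForm 𝒮ℒ k) : Hol :=
  ⟨⇑g, ModularFormClass.holo g⟩

/-- The normalised Eisenstein series of weight `4`. -/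
def E4 : Hol := formToHol ModularForm.E₄

/-- The normalised Eisenstein series of weight `6`. -/
def E6 : Hol := formToHol ModularForm.E₆

/-- The Ramanujan-Serre operator `D_k f = (2πi)⁻¹ f' - (k / 12) E₂ f`. -/
def serreD (k : ℝ) : Hol →ₗ[ℂ] Hol where
  toFun f := ⟨Derivative.serreDerivative (k : ℂ) f.1,
    Derivative.serreDerivative_mdifferentiable _ f.2⟩
  map_add' f g := Subtype.ext (Derivative.serreDerivative_add _ f.1 g.1 f.2 g.2)
  map_smul' c f := Subtype.ext (Derivative.serreDerivative_smul _ c f.1 f.2)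

/-- The iterated operator `D_{k+2n-2} ∘ ⋯ ∘ D_{k+2} ∘ D_k` (`n` factors). -/
def serreIter (k : ℝ) : ℕ → (Hol →ₗ[ℂ] Hol)
  | 0 => LinearMap.id
  | n + 1 => serreD (k + 2 * n) ∘ₗ serreIter k n

/-- A modular linear differential equation
`g₀ D_k^N f + g₁ D_k^(N-1) f + ⋯ + g_N f = 0` of weight `k` and order `N`: the coefficient `g_i` is
a modular form of level one and weight `l + 2i` for some `l ≥ 0`, and `g₀ ≠ 0`. -/
structure MLDE (k : ℝ) (N : ℕ) where
  /-- The weight of the leading coefficient. -/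
  l : ℕ
  /-- The coefficients `g_0, ..., g_N`. -/
  coeff : (i : Fin (N + 1)) → ModularForm 𝒮ℒ ((l : ℤ) + 2 * (i : ℕ))
  /-- The leading coefficient is not zero. -/
  coeff_zero_ne_zero : coeff 0 ≠ 0

/-- The equation is monic: `l = 0` and `g₀ = 1`. -/
def MLDE.IsMonic {k : ℝ} {N : ℕ} (e : MLDE k N) : Prop :=
  e.l = 0 ∧ ∀ z : ℍ, e.coeff 0 z = 1

/-- The holomorphic function `f` is a solution. -/
def MLDE.IsSolution {k : ℝ} {N : ℕ} (e : MLDE k N) (f : Hol) : Prop :=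
  ∑ i : Fin (N + 1), formToHol (e.coeff i) * serreIter k (N - (i : ℕ)) f = 0

/-- The space `H = ⨁_{r ∈ ℝ} H_r`, where every `H_r` is the space of holomorphic functions. -/
abbrev H : Type := ⨁ _ : ℝ, Hol

/-- The element `(f, r)` of `H`: the function `f` placed in weight `r`. -/
def inWeight (r : ℝ) : Hol →ₗ[ℂ] H := DirectSum.lof ℂ ℝ (fun _ => Hol) r

/-- The endomorphism `(f, r) ↦ (D_r f, r + 2)` of `H`. -/
def delta : Module.End ℂ H :=
  DirectSum.toModule ℂ ℝ H fun r => inWeight (r + 2) ∘ₗ serreD r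

/-- The endomorphism `(f, r) ↦ (E₄ f, r + 4)` of `H`. -/
def e4 : Module.End ℂ H :=
  DirectSum.toModule ℂ ℝ H fun r => inWeight (r + 4) ∘ₗ LinearMap.mulLeft ℂ E4

/-- The endomorphism `(f, r) ↦ (E₆ f, r + 6)` of `H`. -/
def e6 : Module.End ℂ H :=
  DirectSum.toModule ℂ ℝ H fun r => inWeight (r + 6) ∘ₗ LinearMap.mulLeft ℂ E6

/-- The algebra of modular linear differential operators, generated by `δ`, `e₄` and `e₆`. -/
def MLDO : Subalgebra ℂ (Module.End ℂ H) := Algebra.adjoin ℂ {delta, e4, e6}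

/-- The subalgebra generated by `e₄` and `e₆`, a copy of the ring of modular forms. -/
def MLDOCoeff : Subalgebra ℂ (Module.End ℂ H) := Algebra.adjoin ℂ {e4, e6}

/-- The monic modular linear differential operators of order `N`, that is, those of the form
`δ^N + a_{N-1} δ^{N-1} + ⋯ + a_1 δ + a_0` with modular coefficients (of arbitrary,
possibly mixed weights). -/
def monicMLDO (N : ℕ) : Set (Module.End ℂ H) :=
  {a | a ∈ MLDO ∧ ∃ c : Fin N → MLDOCoeff,
    a = delta ^ N + ∑ i : Fin N, (c i : Module.End ℂ H) * delta ^ (i : ℕ)}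

/-- The modular order of `φ`: the least `N` such that some monic operator of order `N`
annihilates `φ`, and `∞` if there is none. -/
def mord (φ : H) : ℕ∞ :=
  sInf {x : ℕ∞ | ∃ N : ℕ, x = N ∧ ∃ a ∈ monicMLDO N, a φ = 0}

end

end ModularLDE

/-!
By Ramanujan's identities `D E₄ = -E₆ / 3` and `D E₆ = -E₄² / 2`, and because the discriminant
`(E₄³ - E₆²) / 1728` has no zero, `E₄` and `E₆` have simple zeros at `ρ` and `i`. Let `A` be one of
them, `z` its zero and `f = E₄^m E₆^n = A^j u` with `u z ≠ 0`. As long as `N ≤ j`, the function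
`D^N f` is divisible by exactly `A^(j-N)` near `z`, whereas `f, …, D^(N-1) f` are divisible by
`A^(j-N+1)`, so `D^N f` is not a combination of them with holomorphic coefficients. Hence an
annihilating operator has order greater than both `m` and `n`.

Conversely each `y` among `E₄`, `E₆`, `E₄ E₆` satisfies a second order equation `D² y = c E₄ y`, and
`y^n` is a solution of its `n`-th symmetric power, which is monic of order `n + 1`.
-/

namespace ModularLDE

open UpperHalfPlane
open scoped Manifold MatrixGroups DirectSum

noncomputable section

open Filter Topology ModularForm Function.Periodic Derivative

lemma tendsto_atImInfty_of_hasSum_qExpansion {f : ℍ → ℂ} {c : ℕ → ℂ} {h : ℝ} (hh : 0 < h)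
    (hf : ∀ τ : ℍ, HasSum (fun m ↦ c m • qParam h τ ^ m) (f τ)) :
    Tendsto f atImInfty (𝓝 (c 0)) := by
  have hq (τ : ℍ) : qParam h τ ≠ 0 := qParam_ne_zero _
  have hbdd : IsBoundedAtImInfty fun τ ↦ (f τ - c 0) / qParam h τ := by
    refine isBoundedAtImInfty_of_hasSum_qExpansion hh (c := fun m ↦ c (m + 1)) fun τ ↦ ?_
    have htail := ((hasSum_nat_add_iff' 1).mpr (hf τ)).div_const (qParam h τ)
    simpa [pow_succ, ← mul_assoc, hq τ] using htail
  have hzero : Tendsto (fun τ : ℍ ↦ qParam h τ * ((f τ - c 0) / qParam h τ)) atImInfty (𝓝 0) :=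
    (qParam_tendsto_atImInfty hh).zero_mul_isBoundedUnder_le hbdd.isBoundedUnder_le
  simpa [mul_div_cancel₀, hq] using hzero.add_const (c 0)

lemma tendsto_E2_atImInfty : Tendsto EisensteinSeries.E2 atImInfty (𝓝 1) :=
  tendsto_atImInfty_of_hasSum_qExpansion one_pos
    (c := fun m ↦ if m = 0 then 1 else -24 * (ArithmeticFunction.sigma 1 m : ℂ)) fun τ ↦ by
      simpa only [qParam, Complex.ofReal_one, div_one] using
        EisensteinSeries.hasSum_qExpansion_E2 (z := τ)

lemma tendsto_modularForm_atImInfty {k : ℤ} (f : ModularForm 𝒮ℒ k) :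
    Tendsto f atImInfty (𝓝 ((qExpansion 1 f).coeff 0)) :=
  tendsto_atImInfty_of_hasSum_qExpansion one_pos
    (ModularForm.hasSum_qExpansion f one_pos one_mem_strictPeriods_SL)

lemma tendsto_E₄_atImInfty : Tendsto E₄ atImInfty (𝓝 1) := by
  simpa only [EisensteinSeries.E_qExpansion_coeff_zero _ (show Even 4 from ⟨2, rfl⟩)] using
    tendsto_modularForm_atImInfty E₄

lemma tendsto_E₆_atImInfty : Tendsto E₆ atImInfty (𝓝 1) := by
  simpa only [EisensteinSeries.E_qExpansion_coeff_zero _ (show Even 6 from ⟨3, rfl⟩)] using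
    tendsto_modularForm_atImInfty E₆

lemma isZeroAtImInfty_normalizedDerivOfComplex {f : ℍ → ℂ} (hf : MDiff f)
    (hb : IsBoundedAtImInfty f) : IsZeroAtImInfty (normalizedDerivOfComplex f) := by
  obtain ⟨M, A, hM⟩ := isBoundedAtImInfty_iff.mp hb
  have hder : ∀ τ : ℍ, 2 * A ≤ τ.im → ‖deriv (f ∘ ofComplex) τ‖ ≤ M / (τ.im / 2) := by
    intro τ hτ
    have him : ∀ z ∈ Metric.closedBall (τ : ℂ) (τ.im / 2), τ.im / 2 ≤ z.im := by
      intro z hz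
      have := (Complex.abs_im_le_norm (z - τ)).trans (mem_closedBall_iff_norm.mp hz)
      rw [Complex.sub_im, coe_im] at this
      linarith [(abs_le.mp this).1]
    refine Complex.norm_deriv_le_of_forall_mem_sphere_norm_le (half_pos τ.im_pos) ?_ ?_
    · have hdiff := UpperHalfPlane.mdifferentiable_iff.mp hf
      refine DifferentiableOn.diffContOnCl (hdiff.mono fun z hz ↦ ?_)
      exact (half_pos τ.im_pos).trans_le (him z (Metric.closure_ball_subset_closedBall hz))
    · intro z hz
      have hz' := him z (Metric.sphere_subset_closedBall hz)
      have hzpos : 0 < z.im := (half_pos τ.im_pos).trans_le hz'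
      simpa [ofComplex_apply_of_im_pos hzpos] using hM ⟨z, hzpos⟩ (by simpa using by linarith)
  have hlim : Tendsto (fun τ : ℍ ↦ M / (τ.im / 2)) atImInfty (𝓝 0) :=
    tendsto_const_nhds.div_atTop (tendsto_comap.atTop_div_const two_pos)
  have hderiv : Tendsto (fun τ : ℍ ↦ deriv (f ∘ ofComplex) τ) atImInfty (𝓝 0) :=
    squeeze_zero_norm' (eventually_of_mem (preimage_mem_comap (Ici_mem_atTop (2 * A))) hder) hlim
  simpa only [mul_zero] using! hderiv.const_mul (2 * Real.pi * Complex.I)⁻¹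

lemma tendsto_serreDerivative_atImInfty {f : ℍ → ℂ} {a : ℂ} (k : ℂ) (hf : MDiff f)
    (ha : Tendsto f atImInfty (𝓝 a)) :
    Tendsto (serreDerivative k f) atImInfty (𝓝 (-(k / 12) * a)) := by
  have hD : Tendsto (normalizedDerivOfComplex f) atImInfty (𝓝 0) :=
    isZeroAtImInfty_normalizedDerivOfComplex hf (ha.isBigO_one ℝ)
  convert! hD.sub ((tendsto_E2_atImInfty.const_mul (k * 12⁻¹)).mul ha) using 2
  ring

/-- The Serre derivative of a level one modular form, as a modular form of weight two higher. -/
def serreForm {k : ℤ} (f : ModularForm 𝒮ℒ k) : ModularForm 𝒮ℒ (k + 2) where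
  toFun := serreDerivative k f
  slash_action_eq' A hA := by
    obtain ⟨γ, rfl⟩ := hA
    exact serreDerivative_slash_invariant (ModularFormClass.holo f)
      (SlashInvariantFormClass.slash_action_eq f _ ⟨γ, rfl⟩)
  holo' := serreDerivative_mdifferentiable _ (ModularFormClass.holo f)
  bdd_at_cusps' hc := by
    rw [Subgroup.IsArithmetic.isCusp_iff_isCusp_SL2Z] at hc
    rw [OnePoint.isBoundedAt_iff_forall_SL2Z hc]
    intro γ _
    have hγ : serreDerivative k f ∣[k + 2] γ = serreDerivative k f :=
      serreDerivative_slash_invariant (ModularFormClass.holo f)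
        (SlashInvariantFormClass.slash_action_eq f _ ⟨γ, rfl⟩)
    change IsBoundedAtImInfty (serreDerivative k f ∣[k + 2] γ)
    rw [hγ]
    exact (tendsto_serreDerivative_atImInfty k (ModularFormClass.holo f)
      (tendsto_modularForm_atImInfty f)).isBigO_one ℝ

lemma eq_smul_of_rank_eq_one {Γ : Subgroup (GL (Fin 2) ℝ)} [Γ.HasDetOne] {k : ℤ}
    (hk : Module.rank ℂ (ModularForm Γ k) = 1) {f g : ModularForm Γ k} {a : ℂ}
    (hg : Tendsto g atImInfty (𝓝 1)) (hf : Tendsto f atImInfty (𝓝 a)) : f = a • g := by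
  have hg0 : g ≠ 0 := by
    rintro rfl
    exact zero_ne_one (tendsto_nhds_unique (tendsto_const_nhds (x := (0 : ℂ))) hg)
  obtain ⟨c, rfl⟩ := (finrank_eq_one_iff_of_nonzero' g hg0).mp
    (Module.rank_eq_one_iff_finrank_eq_one.mp hk) f
  have hc : Tendsto (c • g) atImInfty (𝓝 c) := by simpa using! hg.const_smul c
  rw [tendsto_nhds_unique hf hc]

lemma serreForm_eq_smul {k : ℤ} (hk : Module.rank ℂ (ModularForm 𝒮ℒ (k + 2)) = 1)
    {f : ModularForm 𝒮ℒ k} {g : ModularForm 𝒮ℒ (k + 2)} (hf : Tendsto f atImInfty (𝓝 1))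
    (hg : Tendsto g atImInfty (𝓝 1)) : serreForm f = (-(k / 12) : ℂ) • g :=
  eq_smul_of_rank_eq_one hk hg <| by
    simpa using! tendsto_serreDerivative_atImInfty k (ModularFormClass.holo f) hf

lemma formToHol_serreForm {k : ℤ} (f : ModularForm 𝒮ℒ k) :
    formToHol (serreForm f) = serreD k (formToHol f) :=
  Subtype.ext (congrArg (serreDerivative · f) (Complex.ofReal_intCast k).symm)

lemma formToHol_smul {k : ℤ} (c : ℂ) (g : ModularForm 𝒮ℒ k) :
    formToHol (c • g) = c • formToHol g := rfl

lemma rank_modularForm_weight_eight : Module.rank ℂ (ModularForm 𝒮ℒ 8) = 1 := by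
  simpa [Nat.ModEq] using dimension_level_one 8 ⟨4, rfl⟩

theorem serreD_E4 : serreD 4 E4 = (-(1 / 3) : ℂ) • E6 := by
  have h := congrArg formToHol (serreForm_eq_smul (k := 4) levelOne_weight_six_rank_one
    tendsto_E₄_atImInfty tendsto_E₆_atImInfty)
  rw [formToHol_serreForm, formToHol_smul] at h
  convert! h using 2
  norm_num

theorem serreD_E6 : serreD 6 E6 = (-(1 / 2) : ℂ) • E4 ^ 2 := by
  have hlim : Tendsto (E₄.mul E₄) atImInfty (𝓝 1) := by
    simpa using! tendsto_E₄_atImInfty.mul tendsto_E₄_atImInfty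
  have h := congrArg formToHol (serreForm_eq_smul (k := 6) rank_modularForm_weight_eight
    tendsto_E₆_atImInfty hlim)
  rw [formToHol_serreForm, formToHol_smul] at h
  rw [pow_two]
  convert! h using 2
  norm_num

lemma modularForm_eq_zero_of_smul_eq {k : ℤ} (f : ModularForm 𝒮ℒ k) {γ : SL(2, ℤ)} {z : ℍ}
    (hz : γ • z = z) (hk : denom γ z ^ k ≠ 1) : f z = 0 := by
  have h := SlashInvariantForm.slash_action_eqn' f (MonoidHom.mem_range.mpr ⟨γ, rfl⟩) z
  change f (γ • z) = denom γ z ^ k * f z at h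
  rw [hz] at h
  by_contra hf
  exact hk ((mul_eq_right₀ hf).mp h.symm)

lemma E₆_I : E₆ I = 0 := by
  refine modularForm_eq_zero_of_smul_eq E₆
    (ModularGroup.stabilizer_I.mpr (by simp : ModularGroup.S ∈ _)) ?_
  rw [ModularGroup.denom_S, coe_I, zpow_ofNat, show Complex.I ^ 6 = -1 by
    linear_combination (Complex.I ^ 4 - Complex.I ^ 2 + 1) * Complex.I_sq]
  norm_num

lemma E₄_ρ : E₄ ρ = 0 := by
  refine modularForm_eq_zero_of_smul_eq E₄
    (ModularGroup.stabilizer_ρ.mpr (by simp : ModularGroup.T⁻¹ * ModularGroup.S ∈ _)) ?_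
  have hden : denom (ModularGroup.T⁻¹ * ModularGroup.S : SL(2, ℤ)) ρ = ρ := by
    rw [ModularGroup.denom_apply, Matrix.SpecialLinearGroup.coe_mul, ModularGroup.coe_T_inv,
      ModularGroup.coe_S]
    simp
  rw [hden, zpow_ofNat, show (ρ : ℂ) ^ 4 = ρ by
    linear_combination (ρ ^ 2 - ρ : ℂ) * ρ_sq]
  simp [Complex.ext_iff, ρ]

lemma E₆_ne_zero_of_E₄_eq_zero {z : ℍ} (h : E₄ z = 0) : E₆ z ≠ 0 := by
  intro h6
  apply discriminant_ne_zero z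
  rw [discriminant_eq_E₄_cube_sub_E₆_sq, h, h6]
  simp

lemma serreD_mul {r a b : ℝ} (h : r = a + b) (f g : Hol) :
    serreD r (f * g) = serreD a f * g + f * serreD b g := by
  subst h
  have hmul := serreDerivative_mul a b f.1 g.1 f.2 g.2
  rw [← Complex.ofReal_add] at hmul
  exact Subtype.ext hmul

lemma serreD_one : serreD 0 1 = 0 := by
  simpa using serreD_mul (r := 0) (a := 0) (b := 0) (by simp) 1 1

lemma serreD_pow {r w : ℝ} {n : ℕ} (h : r = w * n) (f : Hol) :
    serreD r (f ^ n) = n * f ^ (n - 1) * serreD w f := by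
  subst h
  induction n with
  | zero => simpa using serreD_one
  | succ n ih =>
    rw [pow_succ, serreD_mul (a := w * n) (b := w) (by push_cast; ring), ih]
    cases n with
    | zero => simp
    | succ n => simp; ring

lemma serreIter_succ (k : ℝ) (n : ℕ) (f : Hol) :
    serreIter k (n + 1) f = serreD (k + 2 * n) (serreIter k n f) := rfl

instance : NoZeroDivisors Hol where
  eq_zero_or_eq_zero_of_mul_eq_zero {f g} h :=
    ((UpperHalfPlane.mul_eq_zero_iff f.2 g.2).mp (congrArg Subtype.val h)).imp
      Subtype.ext Subtype.ext

section Divisibility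

variable {A : Hol}

lemma pow_dvd_serreD (k : ℝ) {f : Hol} {j : ℕ} (h : A ^ (j + 1) ∣ f) : A ^ j ∣ serreD k f := by
  obtain ⟨g, rfl⟩ := h
  rw [serreD_mul (a := 0 * (j + 1 : ℕ)) (b := k) (by simp), serreD_pow rfl, Nat.add_sub_cancel]
  exact ⟨(j + 1 : ℕ) * serreD 0 A * g + A * serreD k g, by ring⟩

lemma pow_dvd_serreIter (k : ℝ) {f : Hol} {i j : ℕ} (h : A ^ (j + i) ∣ f) :
    A ^ j ∣ serreIter k i f := by
  induction i generalizing j with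
  | zero => exact h
  | succ i ih => exact pow_dvd_serreD _ (ih (by rwa [add_right_comm, add_assoc]))

/- Only the terms in which every derivative falls on a power of `A` lose a factor `A` per
derivative. -/
lemma pow_succ_dvd_serreIter_sub (k w : ℝ) (u : Hol) (i j : ℕ) :
    A ^ (j + 1) ∣ serreIter k i (A ^ (j + i) * u) -
      (j + i).descFactorial i * (A ^ j * (serreD w A ^ i * u)) := by
  induction i generalizing j with
  | zero => simp [serreIter]
  | succ i ih =>
    set x := serreD w A ^ i * u
    set b := k + 2 * i - w * (j + 1 : ℕ) with hb
    have hlead : serreD (k + 2 * i) (A ^ (j + 1) * x) =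
        (j + 1 : ℕ) * (A ^ j * (serreD w A * x)) + A ^ (j + 1) * serreD b x := by
      rw [serreD_mul (a := w * (j + 1 : ℕ)) (b := b) (by rw [hb]; ring), serreD_pow rfl,
        Nat.add_sub_cancel]
      ring
    have hdesc : (j + (i + 1)).descFactorial (i + 1) = (j + 1 + i).descFactorial i * (j + 1) := by
      rw [show j + (i + 1) = j + 1 + i by ring, Nat.descFactorial_succ, Nat.add_sub_cancel,
        mul_comm]
    have hrest := pow_dvd_serreD (k + 2 * i) (ih (j + 1))
    rw [map_sub, ← nsmul_eq_mul, map_nsmul, nsmul_eq_mul, hlead] at hrest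
    convert! hrest.add
      (dvd_mul_left (A ^ (j + 1)) ((j + 1 + i).descFactorial i * serreD b x)) using 1
    rw [serreIter_succ, hdesc, show j + (i + 1) = j + 1 + i by ring, pow_succ' (serreD w A)]
    push_cast
    ring

/-- The ideal generated by `f, D_k f, …, D_k^(N-1) f`. It contains `D_k^N f` if and only if `f`
satisfies a monic differential equation of order `N` with holomorphic, not necessarily modular,
coefficients. -/
def derivIdeal (k : ℝ) (f : Hol) (N : ℕ) : Ideal Hol :=
  Ideal.span ((fun i ↦ serreIter k i f) '' Set.Iio N)

lemma serreIter_mem_derivIdeal (k : ℝ) (f : Hol) {i N : ℕ} (h : i < N) :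
    serreIter k i f ∈ derivIdeal k f N :=
  Ideal.subset_span ⟨i, h, rfl⟩

lemma pow_dvd_of_mem_derivIdeal {k : ℝ} {f g : Hol} {j N : ℕ} (hf : A ^ (j + N) ∣ f)
    (hg : g ∈ derivIdeal k f N) : A ^ (j + 1) ∣ g := by
  rw [← Ideal.mem_span_singleton]
  refine Ideal.span_le.mpr ?_ hg
  rintro _ ⟨i, hi, rfl⟩
  refine Ideal.mem_span_singleton.mpr (pow_dvd_serreIter k ((pow_dvd_pow A ?_).trans hf))
  have := Set.mem_Iio.mp hi
  lia

theorem lt_of_serreIter_mem_derivIdeal {k w : ℝ} {u : Hol} {z : ℍ} {m N : ℕ} (hA : A.1 z = 0)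
    (hA' : (serreD w A).1 z ≠ 0) (hu : u.1 z ≠ 0)
    (h : serreIter k N (A ^ m * u) ∈ derivIdeal k (A ^ m * u) N) : m < N := by
  by_contra! hN
  obtain ⟨j, rfl⟩ := Nat.exists_eq_add_of_le' hN
  have hA0 : A ≠ 0 := by
    rintro rfl
    exact hA' (by simp)
  have hdvd : A ^ (j + 1) ∣ (j + N).descFactorial N * (A ^ j * (serreD w A ^ N * u)) :=
    (dvd_sub_right (pow_dvd_of_mem_derivIdeal (Dvd.intro u rfl) h)).mp
      (pow_succ_dvd_serreIter_sub k w u N j)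
  obtain ⟨g, hg⟩ : A ∣ (j + N).descFactorial N * (serreD w A ^ N * u) := by
    rw [pow_succ, mul_left_comm] at hdvd
    exact (mul_dvd_mul_iff_left (pow_ne_zero j hA0)).mp hdvd
  have hz : ((j + N).descFactorial N : ℂ) * ((serreD w A).1 z ^ N * u.1 z) = A.1 z * g.1 z :=
    congrFun (congrArg Subtype.val hg) z
  rw [hA, zero_mul] at hz
  refine mul_ne_zero ?_ (mul_ne_zero (pow_ne_zero N hA') hu) hz
  exact_mod_cast (Nat.descFactorial_pos.mpr (Nat.le_add_left N j)).ne'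

end Divisibility

theorem max_lt_of_serreIter_mem_derivIdeal {k : ℝ} {m n N : ℕ}
    (h : serreIter k N (E4 ^ m * E6 ^ n) ∈ derivIdeal k (E4 ^ m * E6 ^ n) N) : max m n < N := by
  refine max_lt ?_ ?_
  · have h6 : E₆ ρ ≠ 0 := E₆_ne_zero_of_E₄_eq_zero E₄_ρ
    refine lt_of_serreIter_mem_derivIdeal (w := 4) E₄_ρ ?_ (pow_ne_zero n h6) h
    rw [serreD_E4]
    exact mul_ne_zero (by norm_num) h6
  · have h4 : E₄ I ≠ 0 := fun h4 ↦ E₆_ne_zero_of_E₄_eq_zero h4 E₆_I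
    rw [mul_comm] at h
    refine lt_of_serreIter_mem_derivIdeal (w := 6) E₆_I ?_ (pow_ne_zero m h4) h
    rw [serreD_E6]
    exact mul_ne_zero (by norm_num) (pow_ne_zero 2 h4)

lemma MLDE.IsMonic.serreIter_mem_derivIdeal {k : ℝ} {N : ℕ} {e : MLDE k N} (he : e.IsMonic)
    {f : Hol} (hf : e.IsSolution f) : serreIter k N f ∈ derivIdeal k f N := by
  have h0 : formToHol (e.coeff 0) = 1 := Subtype.ext (funext he.2)
  rw [MLDE.IsSolution, Fin.sum_univ_succ, h0, one_mul] at hf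
  rw [show serreIter k N f = _ from eq_neg_of_add_eq_zero_left hf]
  exact neg_mem (sum_mem fun i _ ↦ Ideal.mul_mem_left _ _
    (ModularLDE.serreIter_mem_derivIdeal k f (Nat.sub_lt i.pos i.val.succ_pos)))

lemma linearMap_ext_inWeight {M : Type*} [AddCommMonoid M] [Module ℂ M] {a b : H →ₗ[ℂ] M}
    (h : ∀ r f, a (inWeight r f) = b (inWeight r f)) : a = b :=
  DirectSum.linearMap_ext ℂ fun r ↦ LinearMap.ext fun f ↦ h r f

lemma delta_inWeight (r : ℝ) (f : Hol) : delta (inWeight r f) = inWeight (r + 2) (serreD r f) := by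
  simp [delta, inWeight]

lemma delta_pow_inWeight (r : ℝ) (f : Hol) (i : ℕ) :
    (delta ^ i) (inWeight r f) = inWeight (r + 2 * i) (serreIter r i f) := by
  induction i with
  | zero => simp [serreIter]
  | succ i ih =>
    rw [pow_succ', Module.End.mul_apply, ih, delta_inWeight, serreIter_succ,
      show r + 2 * i + 2 = r + 2 * (i + 1 : ℕ) by push_cast; ring]

/-- The endomorphism `(f, r) ↦ (g f, r + w)` of `H`, so that `e4` and `e6` are multiplication by
`E4` in weight `4` and by `E6` in weight `6`. -/
def mulEnd (w : ℝ) (g : Hol) : Module.End ℂ H :=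
  DirectSum.toModule ℂ ℝ H fun r ↦ inWeight (r + w) ∘ₗ LinearMap.mulLeft ℂ g

lemma e4_eq_mulEnd : e4 = mulEnd 4 E4 := rfl

lemma e6_eq_mulEnd : e6 = mulEnd 6 E6 := rfl

lemma mulEnd_inWeight (w r : ℝ) (g f : Hol) :
    mulEnd w g (inWeight r f) = inWeight (r + w) (g * f) := by
  simp [mulEnd, inWeight]

lemma mulEnd_smul (w : ℝ) (c : ℂ) (g : Hol) : mulEnd w (c • g) = c • mulEnd w g :=
  linearMap_ext_inWeight fun r f ↦ by simp [mulEnd_inWeight]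

lemma mulEnd_mul (v w : ℝ) (g h : Hol) : mulEnd (v + w) (g * h) = mulEnd v g * mulEnd w h :=
  linearMap_ext_inWeight fun r f ↦ by
    simp only [Module.End.mul_apply, mulEnd_inWeight, mul_assoc, add_comm v w, add_assoc]

lemma delta_mul_mulEnd (w : ℝ) (g : Hol) :
    delta * mulEnd w g = mulEnd w g * delta + mulEnd (w + 2) (serreD w g) := by
  refine linearMap_ext_inWeight fun r f ↦ ?_
  simp only [LinearMap.add_apply, Module.End.mul_apply, mulEnd_inWeight, delta_inWeight]
  rw [serreD_mul (add_comm r w), map_add, add_comm (inWeight _ _), ← add_assoc r w 2,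
    add_right_comm r w 2]

lemma delta_mul_e4 : delta * e4 = e4 * delta + (-(1 / 3) : ℂ) • e6 := by
  rw [e4_eq_mulEnd, delta_mul_mulEnd, serreD_E4, mulEnd_smul, e6_eq_mulEnd]
  norm_num

lemma delta_mul_e6 : delta * e6 = e6 * delta + (-(1 / 2) : ℂ) • e4 ^ 2 := by
  rw [e6_eq_mulEnd, delta_mul_mulEnd, serreD_E6, mulEnd_smul, pow_two, pow_two, e4_eq_mulEnd,
    ← mulEnd_mul]
  norm_num

lemma e4_mem_MLDOCoeff : e4 ∈ MLDOCoeff := Algebra.subset_adjoin (by simp)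

lemma e6_mem_MLDOCoeff : e6 ∈ MLDOCoeff := Algebra.subset_adjoin (by simp)

lemma exists_delta_mul_eq {c : Module.End ℂ H} (hc : c ∈ MLDOCoeff) :
    ∃ d ∈ MLDOCoeff, delta * c = c * delta + d := by
  induction hc using Algebra.adjoin_induction with
  | mem c hc =>
    rcases hc with rfl | rfl
    · exact ⟨_, Subalgebra.smul_mem _ e6_mem_MLDOCoeff _, delta_mul_e4⟩
    · exact ⟨_, Subalgebra.smul_mem _ (pow_mem e4_mem_MLDOCoeff 2) _, delta_mul_e6⟩
  | algebraMap a => exact ⟨0, zero_mem _, by rw [add_zero, Algebra.commutes]⟩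
  | add c c' _ _ hc hc' =>
    obtain ⟨d, hd, h⟩ := hc
    obtain ⟨d', hd', h'⟩ := hc'
    exact ⟨d + d', add_mem hd hd', by rw [mul_add, add_mul, h, h', add_add_add_comm]⟩
  | mul c c' hc hc' ihc ihc' =>
    obtain ⟨d, hd, h⟩ := ihc
    obtain ⟨d', hd', h'⟩ := ihc'
    exact ⟨c * d' + d * c', add_mem (mul_mem hc hd') (mul_mem hd hc'), by
      rw [← mul_assoc, h, add_mul, mul_assoc, h', mul_add, ← mul_assoc, add_assoc]⟩

/-- The sum of the components of an element of `H`: forgetting the weights turns the coefficients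
of an operator into multiplications by holomorphic functions. -/
def total : H →ₗ[ℂ] Hol := DirectSum.toModule ℂ ℝ Hol fun _ ↦ LinearMap.id

lemma total_inWeight (r : ℝ) (f : Hol) : total (inWeight r f) = f := by
  simp [total, inWeight]

lemma total_mulEnd (w : ℝ) (g : Hol) (x : H) : total (mulEnd w g x) = g * total x := by
  have hcomp : total ∘ₗ mulEnd w g = LinearMap.mulLeft ℂ g ∘ₗ total :=
    linearMap_ext_inWeight fun r f ↦ by simp [mulEnd_inWeight, total_inWeight]
  exact LinearMap.congr_fun hcomp x

lemma total_dvd_total_apply {c : Module.End ℂ H} (hc : c ∈ MLDOCoeff) (x : H) :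
    total x ∣ total (c x) := by
  induction hc using Algebra.adjoin_induction generalizing x with
  | mem c hc =>
    rcases hc with rfl | rfl
    · exact Dvd.intro_left _ (total_mulEnd 4 E4 x).symm
    · exact Dvd.intro_left _ (total_mulEnd 6 E6 x).symm
  | algebraMap a =>
    rw [Module.algebraMap_end_apply, map_smul]
    exact dvd_smul_of_dvd a dvd_rfl
  | add c d _ _ hc hd =>
    rw [LinearMap.add_apply, map_add]
    exact dvd_add (hc x) (hd x)
  | mul c d _ _ hc hd => exact (hd x).trans (hc (d x))

/-- The left `ℂ[e₄, e₆]`-module of operators of order less than `N`. -/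
def orderLT (N : ℕ) : Submodule MLDOCoeff (Module.End ℂ H) :=
  Submodule.span MLDOCoeff (Set.range fun i : Fin N ↦ delta ^ (i : ℕ))

lemma delta_pow_mem_orderLT {i N : ℕ} (h : i < N) : delta ^ i ∈ orderLT N :=
  Submodule.subset_span ⟨⟨i, h⟩, rfl⟩

lemma orderLT_mono {M N : ℕ} (h : M ≤ N) : orderLT M ≤ orderLT N := by
  refine Submodule.span_le.mpr ?_
  rintro _ ⟨i, rfl⟩
  exact delta_pow_mem_orderLT (i.2.trans_le h)

lemma mul_mem_orderLT {c a : Module.End ℂ H} {N : ℕ} (hc : c ∈ MLDOCoeff) (ha : a ∈ orderLT N) :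
    c * a ∈ orderLT N :=
  (orderLT N).smul_mem ⟨c, hc⟩ ha

lemma delta_mul_mem_orderLT {a : Module.End ℂ H} {N : ℕ} (ha : a ∈ orderLT N) :
    delta * a ∈ orderLT (N + 1) := by
  induction ha using Submodule.span_induction with
  | mem x hx =>
    obtain ⟨i, rfl⟩ := hx
    simpa only [← pow_succ'] using delta_pow_mem_orderLT (Nat.succ_lt_succ i.2)
  | zero => simp
  | add x y _ _ hx hy => simpa only [mul_add] using add_mem hx hy
  | smul c x hx ihx =>
    obtain ⟨d, hd, hcomm⟩ := exists_delta_mul_eq c.2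
    rw [Subalgebra.smul_def, smul_eq_mul, ← mul_assoc, hcomm, add_mul, mul_assoc]
    exact add_mem (mul_mem_orderLT c.2 ihx) (mul_mem_orderLT hd (orderLT_mono N.le_succ hx))

lemma mem_monicMLDO_iff {a : Module.End ℂ H} {N : ℕ} :
    a ∈ monicMLDO N ↔ ∃ b ∈ orderLT N, a = delta ^ N + b := by
  constructor
  · rintro ⟨-, c, rfl⟩
    exact ⟨_, sum_mem fun i _ ↦ mul_mem_orderLT (c i).2 (delta_pow_mem_orderLT i.2), rfl⟩
  · rintro ⟨b, hb, rfl⟩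
    obtain ⟨c, rfl⟩ := (Submodule.mem_span_range_iff_exists_fun _).mp hb
    have hdelta : delta ∈ MLDO := Algebra.subset_adjoin (by simp)
    have hcoeff : MLDOCoeff ≤ MLDO := Algebra.adjoin_mono (by simp)
    exact ⟨add_mem (pow_mem hdelta N)
      (sum_mem fun i _ ↦ mul_mem (hcoeff (c i).2) (pow_mem hdelta i)), c, rfl⟩

lemma mem_orderLT_of_mem_monicMLDO {a : Module.End ℂ H} {k N : ℕ} (ha : a ∈ monicMLDO k)
    (h : k < N) : a ∈ orderLT N := by
  obtain ⟨b, hb, rfl⟩ := mem_monicMLDO_iff.mp ha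
  exact add_mem (delta_pow_mem_orderLT h) (orderLT_mono h.le hb)

lemma delta_mul_add_mem_monicMLDO {a b : Module.End ℂ H} {N : ℕ} (ha : a ∈ monicMLDO N)
    (hb : b ∈ orderLT (N + 1)) : delta * a + b ∈ monicMLDO (N + 1) := by
  obtain ⟨a', ha', rfl⟩ := mem_monicMLDO_iff.mp ha
  exact mem_monicMLDO_iff.mpr ⟨delta * a' + b, add_mem (delta_mul_mem_orderLT ha') hb, by
    rw [mul_add, ← pow_succ', add_assoc]⟩

lemma total_apply_inWeight_mem_derivIdeal {b : Module.End ℂ H} {N : ℕ} (hb : b ∈ orderLT N)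
    (r : ℝ) (f : Hol) : total (b (inWeight r f)) ∈ derivIdeal r f N := by
  induction hb using Submodule.span_induction with
  | mem x hx =>
    obtain ⟨i, rfl⟩ := hx
    rw [delta_pow_inWeight, total_inWeight]
    exact serreIter_mem_derivIdeal r f i.2
  | zero => simp
  | add x y _ _ hx hy =>
    rw [LinearMap.add_apply, map_add]
    exact add_mem hx hy
  | smul c x _ hx => exact Ideal.mem_of_dvd _ (total_dvd_total_apply c.2 _) hx

theorem serreIter_mem_derivIdeal_of_monicMLDO {a : Module.End ℂ H} {N : ℕ} {r : ℝ} {f : Hol}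
    (ha : a ∈ monicMLDO N) (h : a (inWeight r f) = 0) : serreIter r N f ∈ derivIdeal r f N := by
  obtain ⟨b, hb, rfl⟩ := mem_monicMLDO_iff.mp ha
  have hsum : serreIter r N f + total (b (inWeight r f)) = 0 := by
    rw [← total_inWeight (r + 2 * N) (serreIter r N f), ← delta_pow_inWeight, ← map_add,
      ← LinearMap.add_apply, h, map_zero]
  rw [eq_neg_of_add_eq_zero_left hsum]
  exact neg_mem (total_apply_inWeight_mem_derivIdeal hb r f)

theorem le_mord (r : ℝ) (m n : ℕ) :
    ((max m n + 1 : ℕ) : ℕ∞) ≤ mord (inWeight r (E4 ^ m * E6 ^ n)) := by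
  refine le_sInf ?_
  rintro _ ⟨N, rfl, a, ha, h⟩
  exact_mod_cast max_lt_of_serreIter_mem_derivIdeal (serreIter_mem_derivIdeal_of_monicMLDO ha h)

/-- The operators `L₀ = 1`, `L₁ = δ`, `L_{k+2} = δ L_{k+1} - (k + 1) (n - k) c e₄ L_k`. If `y`
satisfies `D² y = c E₄ y`, then `L_k` sends `y^n` to `n (n - 1) ⋯ (n - k + 1) y^(n-k) (D y)^k`, so
that `L_{n+1}` is the `n`-th symmetric power of the operator `δ² - c e₄`. -/
def symPow (c : ℂ) (n : ℕ) : ℕ → Module.End ℂ H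
  | 0 => 1
  | 1 => delta
  | k + 2 => delta * symPow c n (k + 1) + (-((k + 1) * (n - k) * c) : ℂ) • (e4 * symPow c n k)

theorem symPow_mem_monicMLDO (c : ℂ) (n k : ℕ) : symPow c n k ∈ monicMLDO k := by
  induction k using Nat.twoStepInduction with
  | zero => exact mem_monicMLDO_iff.mpr ⟨0, zero_mem _, by simp [symPow]⟩
  | one => exact mem_monicMLDO_iff.mpr ⟨0, zero_mem _, by simp [symPow]⟩
  | more k ih ih' =>
    rw [symPow, ← smul_mul_assoc]
    exact delta_mul_add_mem_monicMLDO ih' (mul_mem_orderLT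
      (Subalgebra.smul_mem _ e4_mem_MLDOCoeff _) (mem_orderLT_of_mem_monicMLDO ih (by lia)))

lemma serreD_pow_mul_pow {w : ℝ} {y : Hol} {c : ℂ}
    (hy : serreD (w + 2) (serreD w y) = c • (E4 * y)) (j k : ℕ) :
    serreD (w * j + (w + 2) * k) (y ^ j * serreD w y ^ k) =
      j * (y ^ (j - 1) * serreD w y ^ (k + 1)) +
        (k * c) • (E4 * (y ^ (j + 1) * serreD w y ^ (k - 1))) := by
  rw [serreD_mul rfl, serreD_pow rfl, serreD_pow rfl, hy]
  algebra

lemma serreD_descFactorial_smul_pow_mul_pow {w : ℝ} {y : Hol} {c : ℂ}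
    (hy : serreD (w + 2) (serreD w y) = c • (E4 * y)) (n k : ℕ) :
    serreD (w * n + 2 * (k + 1 : ℕ))
        (n.descFactorial (k + 1) • (y ^ (n - (k + 1)) * serreD w y ^ (k + 1))) +
      (-((k + 1) * (n - k) * c) : ℂ) •
        (E4 * (n.descFactorial k • (y ^ (n - k) * serreD w y ^ k))) =
      n.descFactorial (k + 2) • (y ^ (n - (k + 2)) * serreD w y ^ (k + 2)) := by
  obtain hkn | hnk := lt_or_ge k n
  · obtain ⟨j, rfl⟩ := Nat.exists_eq_add_of_le hkn
    have hsub : k + 1 + j - k = j + 1 := by lia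
    have hsub' : k + 1 + j - (k + 1) = j := by lia
    have hsub'' : k + 1 + j - (k + 2) = j - 1 := by lia
    have hweight : w * (k + 1 + j : ℕ) + 2 * (k + 1 : ℕ) = w * j + (w + 2) * (k + 1 : ℕ) := by
      push_cast
      ring
    rw [map_nsmul, hweight, hsub', serreD_pow_mul_pow hy, Nat.descFactorial_succ _ (k + 1),
      Nat.descFactorial_succ, hsub, hsub', hsub'', Nat.add_sub_cancel]
    push_cast
    algebra
  · rw [Nat.descFactorial_of_lt (show n < k + 1 by lia),
      Nat.descFactorial_of_lt (show n < k + 2 by lia)]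
    obtain rfl | hlt := hnk.eq_or_lt
    · simp
    · simp [Nat.descFactorial_of_lt hlt]

theorem symPow_apply_pow {w : ℝ} {y : Hol} {c : ℂ}
    (hy : serreD (w + 2) (serreD w y) = c • (E4 * y)) (n k : ℕ) :
    symPow c n k (inWeight (w * n) (y ^ n)) = inWeight (w * n + 2 * k)
      (n.descFactorial k • (y ^ (n - k) * serreD w y ^ k)) := by
  induction k using Nat.twoStepInduction with
  | zero => simp [symPow]
  | one => simp [symPow, delta_inWeight, serreD_pow rfl, mul_assoc]
  | more k ih ih' =>
    rw [symPow, LinearMap.add_apply, Module.End.mul_apply, LinearMap.smul_apply,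
      Module.End.mul_apply, ih, ih', delta_inWeight, e4_eq_mulEnd, mulEnd_inWeight,
      show w * n + 2 * (k + 1 : ℕ) + 2 = w * n + 2 * (k + 2 : ℕ) by push_cast; ring,
      show w * n + 2 * k + 4 = w * n + 2 * (k + 2 : ℕ) by push_cast; ring, ← map_smul, ← map_add,
      serreD_descFactorial_smul_pow_mul_pow hy]

theorem mord_pow_le {w : ℝ} {y : Hol} {c : ℂ}
    (hy : serreD (w + 2) (serreD w y) = c • (E4 * y)) (n : ℕ) :
    mord (inWeight (w * n) (y ^ n)) ≤ ((n + 1 : ℕ) : ℕ∞) :=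
  sInf_le ⟨n + 1, rfl, symPow c n (n + 1), symPow_mem_monicMLDO c n (n + 1), by
    rw [symPow_apply_pow hy, Nat.descFactorial_of_lt n.lt_succ_self, zero_smul, map_zero]⟩

lemma serreD_serreD_E4 : serreD (4 + 2) (serreD 4 E4) = (1 / 6 : ℂ) • (E4 * E4) := by
  rw [serreD_E4, map_smul, show (4 + 2 : ℝ) = 6 by norm_num, serreD_E6]
  algebra

lemma serreD_E4_sq : serreD 8 (E4 ^ 2) = (-(2 / 3) : ℂ) • (E4 * E6) := by
  rw [serreD_pow (w := 4) (by norm_num), serreD_E4]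
  algebra

lemma serreD_serreD_E6 : serreD (6 + 2) (serreD 6 E6) = (1 / 3 : ℂ) • (E4 * E6) := by
  rw [serreD_E6, map_smul, show (6 + 2 : ℝ) = 8 by norm_num, serreD_E4_sq]
  algebra

lemma serreD_E4_mul_E6 :
    serreD 10 (E4 * E6) = (-(1 / 3) : ℂ) • E6 ^ 2 + (-(1 / 2) : ℂ) • E4 ^ 3 := by
  rw [serreD_mul (a := 4) (b := 6) (by norm_num), serreD_E4, serreD_E6]
  algebra

lemma serreD_serreD_E4_mul_E6 :
    serreD (10 + 2) (serreD 10 (E4 * E6)) = (5 / 6 : ℂ) • (E4 * (E4 * E6)) := by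
  rw [serreD_E4_mul_E6, map_add, map_smul, map_smul, serreD_pow (w := 6) (by norm_num),
    serreD_pow (w := 4) (by norm_num), serreD_E4, serreD_E6]
  algebra

theorem mainTheorem1_general :
    (∀ (k : ℝ) (m n N : ℕ),
      (∃ e : MLDE k N, e.IsMonic ∧ e.IsSolution (E4 ^ m * E6 ^ n)) → max m n + 1 ≤ N) ∧
    (∀ (r : ℝ) (m n : ℕ), ((max m n + 1 : ℕ) : ℕ∞) ≤ mord (inWeight r (E4 ^ m * E6 ^ n))) ∧
    (∀ n : ℕ,
      mord (inWeight (4 * n : ℝ) (E4 ^ n)) = ((n + 1 : ℕ) : ℕ∞) ∧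
      mord (inWeight (6 * n : ℝ) (E6 ^ n)) = ((n + 1 : ℕ) : ℕ∞) ∧
      mord (inWeight (10 * n : ℝ) (E4 ^ n * E6 ^ n)) = ((n + 1 : ℕ) : ℕ∞)) := by
  refine ⟨fun k m n N ⟨e, he, hs⟩ ↦
      max_lt_of_serreIter_mem_derivIdeal (he.serreIter_mem_derivIdeal hs),
    le_mord, fun n ↦ ⟨?_, ?_, ?_⟩⟩
  · exact (mord_pow_le serreD_serreD_E4 n).antisymm (by simpa using le_mord (4 * n) n 0)
  · exact (mord_pow_le serreD_serreD_E6 n).antisymm (by simpa using le_mord (6 * n) 0 n)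
  · refine le_antisymm ?_ (by simpa using le_mord (10 * n) n n)
    simpa only [mul_pow] using mord_pow_le serreD_serreD_E4_mul_E6 n

end

end ModularLDE

open ModularLDE in
theorem mainTheorem1 :
    (∀ m n N : ℕ, 0 < N →
      (∃ e : MLDE (4 * m + 6 * n : ℝ) N, e.IsMonic ∧ e.IsSolution (E4 ^ m * E6 ^ n)) →
      max m n + 1 ≤ N) ∧
    (∀ m n : ℕ,
      ((max m n + 1 : ℕ) : ℕ∞) ≤ mord (inWeight (4 * m + 6 * n : ℝ) (E4 ^ m * E6 ^ n))) ∧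
    (∀ n : ℕ,
      mord (inWeight (4 * n : ℝ) (E4 ^ n)) = ((n + 1 : ℕ) : ℕ∞) ∧
      mord (inWeight (6 * n : ℝ) (E6 ^ n)) = ((n + 1 : ℕ) : ℕ∞) ∧
      mord (inWeight (10 * n : ℝ) (E4 ^ n * E6 ^ n)) = ((n + 1 : ℕ) : ℕ∞)) :=
  ⟨fun m n N _ ↦ mainTheorem1_general.1 _ m n N, fun m n ↦ mainTheorem1_general.2.1 _ m n,
    mainTheorem1_general.2.2⟩
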